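/- Let $(X,d)$ be a metric space and $1\le p<\infty$. For a fuzzy set $u:X\to[0,1]$ put $[u]_\alpha=\{x\in X:u(x)\ge\alpha\}$ for $\alpha\in(0,1]$ and $[u]_0=\overline{\{x\in X:u(x)>0\}}$. Let $F^1_{USCG}(X)$ be the set of all fuzzy sets $u$ in $X$ such that $[u]_\alpha$ is nonempty and compact for every $\alpha\in(0,1]$. For $u,v\in F^1_{USCG}(X)$ let $$d_p(u,v)=\Big(\int_0^1 H([u]_\alpha,[v]_\alpha)^p\,d\alpha\Big)^{1/p}\in[0,+\infty],$$ where $H$ is the ($[0,+\infty]$-valued) Hausdorff distance induced by $d$ (the integrand is a measurable function of $\alpha\in[0,1]$). For $x\in X$ let $\widehat{x}$ be the fuzzy set with value $1$ at $x$ and $0$ elsewhere, and let $F^1_{USCG}(X)^p$ be the set of all $u\in F^1_{USCG}(X)$ with $d_p(u,\widehat{x_0})<+\infty$ for some (equivalently, every) point $x_0\in X$; $d_p$ is a metric on $F^1_{USCG}(X)^p$. Then $(X,d)$ is complete if and only if $(F^1_{USCG}(X)^p,d_p)$ is complete. In particular, for every $m$, $(F^1_{USCG}(\mathbb{R}^m)^p,d_p)$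 is complete, where $\mathbb{R}^m$ carries the Euclidean metric. -/

import Mathlib

open MeasureTheory Set Filter Topology
open scoped ENNReal

/-- A fuzzy set in `X`: a function from `X` to `[0,1]`. -/
abbrev FuzzySet (X : Type*) := X → unitInterval

namespace FuzzySet

variable {X : Type*}

open Classical in
/-- The fuzzy set `χ_{x}`, with value `1` at `x` and `0` elsewhere. -/
noncomputable def point (x : X) : FuzzySet X := fun y => if y = x then 1 else 0

section Metric

variable [MetricSpace X]

open Classical in
/-- The `α`-cut of `u` (meant for `α ∈ [0,1]`): `{x | u x ≥ α}` if `α ∈ (0,1]`, and the support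
`closure {x | u x > 0}` if `α = 0`. -/
noncomputable def cut (u : FuzzySet X) (α : ℝ) : Set X :=
  if α = 0 then closure {x | 0 < (u x : ℝ)} else {x | α ≤ (u x : ℝ)}

/-- Membership in `F¹_USCG(X)`: every cut with `α ∈ (0,1]` is nonempty and compact. -/
def IsUSCG (u : FuzzySet X) : Prop :=
  ∀ α ∈ Ioc (0 : ℝ) 1, IsCompact (cut u α) ∧ (cut u α).Nonempty

/-- The `d_p` distance, with values in `[0,∞]`:
`d_p(u,v) = (∫₀¹ H([u]_α, [v]_α)^p dα)^{1/p}`, where `H` is the (extended) Hausdorff distance. -/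
noncomputable def dp (p : ℝ) (u v : FuzzySet X) : ℝ≥0∞ :=
  (∫⁻ α in Icc (0 : ℝ) 1, (Metric.hausdorffEDist (cut u α) (cut v α)) ^ p) ^ (1 / p)

theorem cut_of_ne (u : FuzzySet X) {α : ℝ} (h : α ≠ 0) : cut u α = {x | α ≤ (u x : ℝ)} := by
  simp [cut, h]

theorem cut_point (x : X) {α : ℝ} (h : α ∈ Icc (0 : ℝ) 1) : cut (point x) α = {x} := by
  by_cases h0 : α = 0
  · have : {y | 0 < ((point x y : unitInterval) : ℝ)} = {x} := by
      ext y
      by_cases hy : y = x <;> simp [point, hy]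
    simp only [cut, h0, if_true, this, closure_singleton]
  · rw [cut_of_ne _ h0]
    have hpos : 0 < α := lt_of_le_of_ne h.1 (Ne.symm h0)
    ext y
    by_cases hy : y = x
    · simp [point, hy, h.2]
    · simp [point, hy, hpos]

theorem isUSCG_point (x : X) : IsUSCG (point x) := by
  intro α h
  rw [cut_point x ⟨h.1.le, h.2⟩]
  exact ⟨isCompact_singleton, singleton_nonempty x⟩

/-- The cut map is left continuous, for the Hausdorff distance, on `(0,1]`. -/
theorem IsUSCG.left_cont {u : FuzzySet X} (hu : IsUSCG u) {α : ℝ} (h : α ∈ Ioc (0 : ℝ) 1)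
    {ε : ℝ≥0∞} (hε : 0 < ε) :
    ∀ᶠ β in 𝓝[<] α, Metric.hausdorffEDist (cut u β) (cut u α) ≤ ε := by
  have key : ∃ β : Ioo (0 : ℝ) α, cut u β ⊆ {x | Metric.infEDist x (cut u α) < ε} := by
    have : Nonempty (Ioo (0 : ℝ) α) := (nonempty_Ioo.2 h.1).to_subtype
    refine exists_subset_nhds_of_isCompact (V := fun β : Ioo (0 : ℝ) α => cut u β) ?_ ?_ ?_
    · intro a b
      refine ⟨max a b, ?_, ?_⟩
      · intro x hx
        change x ∈ cut u (max a b : Ioo (0 : ℝ) α) at hx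
        change x ∈ cut u a
        rw [cut_of_ne _ (max a b).2.1.ne'] at hx
        rw [cut_of_ne _ a.2.1.ne']
        exact le_trans (Subtype.coe_le_coe.2 (le_max_left a b)) hx
      · intro x hx
        change x ∈ cut u (max a b : Ioo (0 : ℝ) α) at hx
        change x ∈ cut u b
        rw [cut_of_ne _ (max a b).2.1.ne'] at hx
        rw [cut_of_ne _ b.2.1.ne']
        exact le_trans (Subtype.coe_le_coe.2 (le_max_right a b)) hx
    · exact fun β => (hu β ⟨β.2.1, β.2.2.le.trans h.2⟩).1
    · intro x hx
      have hx' : x ∈ cut u α := by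
        rw [cut_of_ne _ h.1.ne']
        change α ≤ (u x : ℝ)
        refine le_of_forall_lt_imp_le_of_dense fun b hb => ?_
        have hm : max b (α / 2) ∈ Ioo (0 : ℝ) α :=
          ⟨lt_max_of_lt_right (by linarith [h.1]), max_lt hb (by linarith [h.1])⟩
        have := mem_iInter.1 hx ⟨_, hm⟩
        rw [cut_of_ne _ hm.1.ne'] at this
        exact (le_max_left _ _).trans this
      refine (isOpen_lt Metric.continuous_infEDist continuous_const).mem_nhds ?_
      simpa [Metric.infEDist_zero_of_mem hx'] using hε
  obtain ⟨β, hβ⟩ := key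
  filter_upwards [Ioo_mem_nhdsLT β.2.2] with γ hγ
  have hγ0 : 0 < γ := β.2.1.trans hγ.1
  refine Metric.hausdorffEDist_le_of_infEDist (fun x hx => ?_) (fun x hx => ?_)
  · refine (hβ (?_ : x ∈ cut u β)).le
    rw [cut_of_ne _ hγ0.ne'] at hx
    rw [cut_of_ne _ β.2.1.ne']
    exact hγ.1.le.trans hx
  · have : x ∈ cut u γ := by
      rw [cut_of_ne _ h.1.ne'] at hx
      rw [cut_of_ne _ hγ0.ne']
      exact hγ.2.le.trans hx
    simp [Metric.infEDist_zero_of_mem this]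

theorem IsUSCG.hausdorffEDist_ne_top {u v : FuzzySet X} (hu : IsUSCG u) (hv : IsUSCG v) {α : ℝ}
    (h : α ∈ Ioc (0 : ℝ) 1) : Metric.hausdorffEDist (cut u α) (cut v α) ≠ ∞ :=
  Metric.hausdorffEDist_ne_top_of_nonempty_of_bounded (hu α h).2 (hv α h).2
    (hu α h).1.isBounded (hv α h).1.isBounded

theorem IsUSCG.tendsto_left {u v : FuzzySet X} (hu : IsUSCG u) (hv : IsUSCG v) {α : ℝ}
    (h : α ∈ Ioc (0 : ℝ) 1) :
    Tendsto (fun β => Metric.hausdorffEDist (cut u β) (cut v β)) (𝓝[<] α)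
      (𝓝 (Metric.hausdorffEDist (cut u α) (cut v α))) := by
  rw [ENNReal.tendsto_nhds (hu.hausdorffEDist_ne_top hv h)]
  intro ε hε
  have h2 : (0 : ℝ≥0∞) < ε / 2 := ENNReal.half_pos hε.ne'
  filter_upwards [hu.left_cont h h2, hv.left_cont h h2] with β h1 h2
  constructor
  · rw [tsub_le_iff_right]
    calc Metric.hausdorffEDist (cut u α) (cut v α)
        ≤ Metric.hausdorffEDist (cut u α) (cut u β)
          + Metric.hausdorffEDist (cut u β) (cut v α) := Metric.hausdorffEDist_triangle
      _ ≤ Metric.hausdorffEDist (cut u α) (cut u β)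
          + (Metric.hausdorffEDist (cut u β) (cut v β)
          + Metric.hausdorffEDist (cut v β) (cut v α)) := by
          gcongr; exact Metric.hausdorffEDist_triangle
      _ ≤ ε / 2 + (Metric.hausdorffEDist (cut u β) (cut v β) + ε / 2) := by
          gcongr; rwa [Metric.hausdorffEDist_comm]
      _ = Metric.hausdorffEDist (cut u β) (cut v β) + (ε / 2 + ε / 2) := by ring
      _ = _ := by rw [ENNReal.add_halves]
  · calc Metric.hausdorffEDist (cut u β) (cut v β)
        ≤ Metric.hausdorffEDist (cut u β) (cut u α)
          + Metric.hausdorffEDist (cut u α) (cut v β) := Metric.hausdorffEDist_triangle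
      _ ≤ Metric.hausdorffEDist (cut u β) (cut u α)
          + (Metric.hausdorffEDist (cut u α) (cut v α)
          + Metric.hausdorffEDist (cut v α) (cut v β)) := by
          gcongr; exact Metric.hausdorffEDist_triangle
      _ ≤ ε / 2 + (Metric.hausdorffEDist (cut u α) (cut v α) + ε / 2) := by
          gcongr; rwa [Metric.hausdorffEDist_comm]
      _ = Metric.hausdorffEDist (cut u α) (cut v α) + (ε / 2 + ε / 2) := by ring
      _ = _ := by rw [ENNReal.add_halves]

theorem ae_mem_Ioc : ∀ᵐ α ∂(volume.restrict (Icc (0 : ℝ) 1)), α ∈ Ioc (0 : ℝ) 1 := by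
  rw [← restrict_Ioc_eq_restrict_Icc]
  exact ae_restrict_mem measurableSet_Ioc

/-- `α ↦ H([u]_α, [v]_α)` is measurable on `[0,1]`, so that the integral in `d_p` is meaningful. -/
theorem IsUSCG.aemeasurable {u v : FuzzySet X} (hu : IsUSCG u) (hv : IsUSCG v) :
    AEMeasurable (fun α => Metric.hausdorffEDist (cut u α) (cut v α))
      (volume.restrict (Icc (0 : ℝ) 1)) := by
  let g : ℕ → ℝ → ℝ := fun n α => ((⌈((n : ℝ) + 1) * α⌉ : ℝ) - 1) / ((n : ℝ) + 1)
  refine aemeasurable_of_tendsto_metrizable_ae atTop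
    (f := fun n α => Metric.hausdorffEDist (cut u (g n α)) (cut v (g n α))) (fun n => ?_) ?_
  · have hm : Measurable fun α : ℝ => ⌈((n : ℝ) + 1) * α⌉ :=
      Int.measurable_ceil.comp (measurable_const.mul measurable_id)
    exact ((measurable_from_top (f := fun k : ℤ => Metric.hausdorffEDist
      (cut u (((k : ℝ) - 1) / ((n : ℝ) + 1))) (cut v (((k : ℝ) - 1) / ((n : ℝ) + 1))))).comp
        hm).aemeasurable
  · filter_upwards [ae_mem_Ioc] with α h
    refine (hu.tendsto_left hv h).comp (tendsto_nhdsWithin_iff.2 ⟨?_, Eventually.of_forall ?_⟩)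
    · have hlim : Tendsto (fun n : ℕ => α - 1 / ((n : ℝ) + 1)) atTop (𝓝 α) := by
        simpa using tendsto_const_nhds.sub (tendsto_one_div_add_atTop_nhds_zero_nat (𝕜 := ℝ))
      refine tendsto_of_tendsto_of_tendsto_of_le_of_le hlim tendsto_const_nhds (fun n => ?_)
        (fun n => ?_)
      · have hn : (0 : ℝ) < (n : ℝ) + 1 := by positivity
        have := Int.le_ceil (((n : ℝ) + 1) * α)
        simp only [g]
        rw [le_div_iff₀ hn, sub_mul, one_div, inv_mul_cancel₀ hn.ne']
        linarith
      · have hn : (0 : ℝ) < (n : ℝ) + 1 := by positivity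
        have := Int.ceil_lt_add_one (((n : ℝ) + 1) * α)
        simp only [g]
        rw [div_le_iff₀ hn]
        linarith
    · intro n
      have hn : (0 : ℝ) < (n : ℝ) + 1 := by positivity
      have := Int.ceil_lt_add_one (((n : ℝ) + 1) * α)
      simp only [g, mem_Iio]
      rw [div_lt_iff₀ hn]
      linarith

theorem dp_self {p : ℝ} (hp : 1 ≤ p) (u : FuzzySet X) : dp p u u = 0 := by
  have h0 : 0 < p := by linarith
  simp [dp, Metric.hausdorffEDist_self, h0]

theorem dp_comm (p : ℝ) (u v : FuzzySet X) : dp p u v = dp p v u := by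
  simp only [dp, Metric.hausdorffEDist_comm]

theorem dp_triangle {p : ℝ} (hp : 1 ≤ p) {u v w : FuzzySet X} (hu : IsUSCG u) (hv : IsUSCG v)
    (hw : IsUSCG w) : dp p u w ≤ dp p u v + dp p v w := by
  have h0 : 0 < p := by linarith
  refine le_trans ?_ (ENNReal.lintegral_Lp_add_le (hu.aemeasurable hv) (hv.aemeasurable hw) hp)
  unfold dp
  gcongr
  exact Metric.hausdorffEDist_triangle

theorem le_of_dp_eq_zero {p : ℝ} (hp : 1 ≤ p) {u v : FuzzySet X} (hu : IsUSCG u) (hv : IsUSCG v)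
    (h : dp p u v = 0) (x : X) : v x ≤ u x := by
  have h0 : 0 < p := by linarith
  have h1 := (ENNReal.rpow_eq_zero_iff_of_pos (by positivity)).1 h
  rw [lintegral_eq_zero_iff' ((hu.aemeasurable hv).pow_const p)] at h1
  by_contra hlt
  rw [not_le] at hlt
  have hlt' : (u x : ℝ) < v x := hlt
  have hsub : Ioc (u x : ℝ) (v x) ⊆ Icc 0 1 := fun α hα =>
    ⟨(u x).2.1.trans hα.1.le, hα.2.trans (v x).2.2⟩
  have h2 : ∀ᵐ α ∂(volume.restrict (Ioc (u x : ℝ) (v x))), False := by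
    filter_upwards [ae_restrict_of_ae_restrict_of_subset hsub h1,
      ae_restrict_mem measurableSet_Ioc] with α hα hm
    have hα0 : 0 < α := (u x).2.1.trans_lt hm.1
    have hI : α ∈ Ioc (0 : ℝ) 1 := ⟨hα0, hm.2.trans (v x).2.2⟩
    have hz := (ENNReal.rpow_eq_zero_iff_of_pos h0).1 hα
    rw [(hu α hI).1.isClosed.hausdorffEDist_zero_iff (hv α hI).1.isClosed] at hz
    have hxv : x ∈ cut v α := by rw [cut_of_ne _ hα0.ne']; exact hm.2
    rw [← hz, cut_of_ne _ hα0.ne'] at hxv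
    exact absurd hm.1 (not_lt.2 hxv)
  simp only [eventually_false_iff_eq_bot, ae_eq_bot, Measure.restrict_eq_zero,
    Real.volume_Ioc, ENNReal.ofReal_eq_zero] at h2
  linarith

theorem dp_point_point {p : ℝ} (hp : 1 ≤ p) (x y : X) :
    dp p (point x) (point y) = edist x y := by
  have h0 : p ≠ 0 := by linarith
  have : ∫⁻ α in Icc (0 : ℝ) 1, (Metric.hausdorffEDist (cut (point x) α) (cut (point y) α)) ^ p
      = ∫⁻ _ in Icc (0 : ℝ) 1, (edist x y) ^ p :=
    setLIntegral_congr_fun measurableSet_Icc fun α hα => by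
      simp only [cut_point x hα, cut_point y hα, Metric.hausdorffEDist_singleton]
  rw [dp, this]
  simp [h0]

end Metric

end FuzzySet

/-- The set `F¹_USCG(X)^p` of all `u ∈ F¹_USCG(X)` with `d_p(u, χ_{x₀}) < ∞` for some point
`x₀` of `X` (equivalently, for every one). -/
structure FuzzyUSCGp (X : Type*) [MetricSpace X] (p : ℝ) where
  /-- the underlying fuzzy set -/
  toFuzzySet : FuzzySet X
  isUSCG : toFuzzySet.IsUSCG
  exists_dp_lt_top : ∃ x₀ : X, FuzzySet.dp p toFuzzySet (FuzzySet.point x₀) < ∞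

namespace FuzzyUSCGp

open FuzzySet

variable {X : Type*} [MetricSpace X] {p : ℝ}

theorem dp_lt_top (hp : 1 ≤ p) (u : FuzzyUSCGp X p) (x : X) :
    dp p u.toFuzzySet (point x) < ∞ := by
  obtain ⟨y, hy⟩ := u.exists_dp_lt_top
  refine (dp_triangle hp u.isUSCG (isUSCG_point y) (isUSCG_point x)).trans_lt ?_
  rw [dp_point_point hp]
  exact ENNReal.add_lt_top.2 ⟨hy, edist_lt_top _ _⟩

theorem dp_ne_top (hp : 1 ≤ p) (u v : FuzzyUSCGp X p) :
    dp p u.toFuzzySet v.toFuzzySet ≠ ∞ := by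
  obtain ⟨y, hy⟩ := v.exists_dp_lt_top
  refine ((dp_triangle hp u.isUSCG (isUSCG_point y) v.isUSCG).trans_lt ?_).ne
  rw [dp_comm p (point y)]
  exact ENNReal.add_lt_top.2 ⟨u.dp_lt_top hp y, hy⟩

/-- `F¹_USCG(X)^p` with the metric `d_p`; its topology and uniformity are those of `d_p`. -/
noncomputable instance instMetricSpace [hp : Fact (1 ≤ p)] : MetricSpace (FuzzyUSCGp X p) where
  dist u v := (dp p u.toFuzzySet v.toFuzzySet).toReal
  edist u v := dp p u.toFuzzySet v.toFuzzySet
  edist_dist u v := (ENNReal.ofReal_toReal (dp_ne_top hp.out u v)).symm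
  dist_self u := by simp [dp_self hp.out]
  dist_comm u v := by rw [dp_comm]
  dist_triangle u v w := by
    rw [← ENNReal.toReal_add (dp_ne_top hp.out u v) (dp_ne_top hp.out v w)]
    exact ENNReal.toReal_mono
      (ENNReal.add_ne_top.2 ⟨dp_ne_top hp.out u v, dp_ne_top hp.out v w⟩)
      (dp_triangle hp.out u.isUSCG v.isUSCG w.isUSCG)
  eq_of_dist_eq_zero := by
    intro u v h
    have h' : dp p u.toFuzzySet v.toFuzzySet = 0 :=
      ((ENNReal.toReal_eq_zero_iff _).1 h).resolve_right (dp_ne_top hp.out u v)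
    have : u.toFuzzySet = v.toFuzzySet := funext fun x => le_antisymm
      (le_of_dp_eq_zero hp.out v.isUSCG u.isUSCG (by rw [dp_comm]; exact h') x)
      (le_of_dp_eq_zero hp.out u.isUSCG v.isUSCG h' x)
    cases u
    cases v
    simpa using this

end FuzzyUSCGp

open Metric TopologicalSpace

namespace FuzzySet

/-! If `FuzzyUSCGp X p` is complete, embed `X` isometrically by crisp points. When crisp points tend
to `u`, any `y` in the `1`-cut of `u` is the limit in `X`, because `y` lies in every positive cut
(`edist_le_dp_point`).

Conversely, let `∑ d_p(u_n, u_{n+1})` be finite. Since `[0,1]` has mass one, the `L¹` norm is at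
most the `L^p` norm, so at almost every level the Hausdorff distances are summable and the cuts
converge to some nonempty compact `K α`, by completeness of `NonemptyCompacts X`. The family `K` is
antitone, and `x ↦ sup {α | x ∈ K α}` has as `α`-cut the intersection of the `K β` with `β < α`.
This differs from `K α` only at left jumps, which separability makes countable
(`countable_left_jumps`). Levelwise convergence thus holds almost everywhere, and Fatou's lemma
turns it into `d_p` convergence. -/

theorem exists_mem_Ioo_of_ae {S : Set ℝ}
    (hS : ∀ᵐ α ∂(volume.restrict (Icc (0 : ℝ) 1)), α ∈ S) {a b : ℝ} (ha : 0 ≤ a) (hab : a < b) (hb : b ≤ 1) : ∃ s ∈ S, s ∈ Ioo a b := by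
  by_contra! h
  have hsub : Ioo a b ⊆ Icc 0 1 := fun x hx => ⟨ha.trans hx.1.le, hx.2.le.trans hb⟩
  have h2 : ∀ᵐ α ∂(volume.restrict (Ioo a b)), False := by
    filter_upwards [ae_restrict_of_ae_restrict_of_subset hsub hS,
      ae_restrict_mem measurableSet_Ioo] with α h1 h2 using h α h1 h2
  simp only [eventually_false_iff_eq_bot, ae_eq_bot, Measure.restrict_eq_zero,
    Real.volume_Ioo, ENNReal.ofReal_eq_zero] at h2
  linarith

section Metric

variable {X : Type*} [MetricSpace X]

/-! ### Fuzzy sets from antitone families of compact sets -/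

theorem cut_anti (u : FuzzySet X) {α β : ℝ} (hα : 0 < α) (h : α ≤ β) : cut u β ⊆ cut u α := by
  intro x hx
  rw [cut_of_ne _ (hα.trans_le h).ne'] at hx
  rw [cut_of_ne _ hα.ne']
  exact h.trans hx

/-- Inclusions pass to limits for the Hausdorff distance. -/
theorem subset_of_tendsto_hausdorffEDist {A B : ℕ → Set X} {A' B' : Set X} (hB : IsClosed B')
    (h : ∀ n, A n ⊆ B n) (hA' : Tendsto (fun n => hausdorffEDist (A n) A') atTop (𝓝 0))
    (hB' : Tendsto (fun n => hausdorffEDist (B n) B') atTop (𝓝 0)) : A' ⊆ B' := by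
  intro x hx
  rw [mem_iff_infEDist_zero_of_closed hB]
  have hlim := hA'.add hB'
  rw [add_zero] at hlim
  refine le_antisymm (ge_of_tendsto' hlim fun n => ?_) zero_le
  calc infEDist x B' ≤ infEDist x (B n) + hausdorffEDist (B n) B' :=
        infEDist_le_infEDist_add_hausdorffEDist
    _ ≤ hausdorffEDist (A n) A' + hausdorffEDist (B n) B' := by
        gcongr
        rw [hausdorffEDist_comm]
        exact (infEDist_anti (h n)).trans (infEDist_le_hausdorffEDist_of_mem hx)

/-- An antitone family of closed sets contained in a separable set has only countably many
left discontinuities. -/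
theorem countable_left_jumps {T : Set X} (hT : IsSeparable T) {S : Set ℝ} {K : ℝ → Set X}
    (hK : ∀ α ∈ S, IsClosed (K α)) :
    {α ∈ S | ∃ x ∈ T, x ∉ K α ∧ ∀ β ∈ S, β < α → x ∈ K β}.Countable := by
  rcases isEmpty_or_nonempty X with hX | hX
  · refine countable_empty.mono ?_
    rintro α ⟨-, x, -⟩
    exact isEmptyElim x
  obtain ⟨c, hc, hTc⟩ := hT
  -- Label each jump with a rational ball centred in the countable set `c` that misses `K α` but
  -- meets every earlier `K β`. Two jumps cannot share a label.
  have key : ∀ α : ℝ, ∃ z : X × ℚ, α ∈ {α ∈ S | ∃ x ∈ T, x ∉ K α ∧ ∀ β ∈ S, β < α → x ∈ K β} →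
      z.1 ∈ c ∧ Disjoint (ball z.1 (z.2 : ℝ)) (K α) ∧
        ∀ β ∈ S, β < α → ¬ Disjoint (ball z.1 (z.2 : ℝ)) (K β) := by
    intro α
    by_cases hα : α ∈ {α ∈ S | ∃ x ∈ T, x ∉ K α ∧ ∀ β ∈ S, β < α → x ∈ K β}
    · obtain ⟨hαS, x, hxT, hxK, hx⟩ := hα
      obtain ⟨ε, hε, hball⟩ := Metric.isOpen_iff.1 (hK α hαS).isOpen_compl x hxK
      obtain ⟨d, hd, hxd⟩ := Metric.mem_closure_iff.1 (hTc hxT) (ε / 2) (half_pos hε)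
      obtain ⟨q, hq1, hq2⟩ := exists_rat_btwn hxd
      refine ⟨(d, q), fun _ => ⟨hd, ?_, fun β hβ hlt => ?_⟩⟩
      · refine Set.disjoint_left.2 fun y hy => hball ?_
        rw [mem_ball] at hy ⊢
        have := dist_triangle y d x
        rw [dist_comm d x] at this
        dsimp only at hy
        linarith
      · exact Set.not_disjoint_iff.2 ⟨x, hq1, hx β hβ hlt⟩
    · exact ⟨Classical.arbitrary _, fun h => absurd h hα⟩
  choose f hf using key
  refine MapsTo.countable_of_injOn (f := f) (t := c ×ˢ univ)
    (fun α hα => ⟨(hf α hα).1, mem_univ _⟩) ?_ (hc.prod countable_univ)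
  intro α hα β hβ h
  rcases lt_trichotomy α β with hlt | heq | hlt
  · have := (hf β hβ).2.2 α hα.1 hlt
    rw [← h] at this
    exact absurd (hf α hα).2.1 this
  · exact heq
  · have := (hf α hα).2.2 β hβ.1 hlt
    rw [h] at this
    exact absurd (hf β hβ).2.1 this

/-- An antitone family of nonempty compact sets, indexed by almost all levels, is up to
countably many levels the family of cuts of a fuzzy set. -/
theorem exists_isUSCG_of_antitoneOn {S : Set ℝ}
    (hS : ∀ᵐ α ∂(volume.restrict (Icc (0 : ℝ) 1)), α ∈ S) (hS1 : S ⊆ Ioc 0 1) {K : ℝ → Set X}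
    (hc : ∀ α ∈ S, IsCompact (K α)) (hn : ∀ α ∈ S, (K α).Nonempty) (hK : AntitoneOn K S) :
    ∃ u : FuzzySet X, IsUSCG u ∧ {α ∈ S | cut u α ≠ K α}.Countable := by
  have hmem0 (x : X) : 0 ≤ sSup {α ∈ S | x ∈ K α} :=
    Real.sSup_nonneg fun α hα => (hS1 hα.1).1.le
  have hmem1 (x : X) : sSup {α ∈ S | x ∈ K α} ≤ 1 :=
    Real.sSup_le (fun α hα => (hS1 hα.1).2) zero_le_one
  -- A point in no `K α` gets the value `sSup ∅ = 0`, as it should.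
  let u : FuzzySet X := fun x => ⟨sSup {α ∈ S | x ∈ K α}, hmem0 x, hmem1 x⟩
  -- The inequality `β < α` must be strict: the supremum may equal `α` without being attained.
  have hcut {α : ℝ} (hα : α ∈ Ioc (0 : ℝ) 1) (x : X) :
      x ∈ cut u α ↔ ∀ β ∈ S, β < α → x ∈ K β := by
    rw [cut_of_ne _ hα.1.ne']
    change α ≤ sSup {α ∈ S | x ∈ K α} ↔ _
    constructor
    · intro h β hβ hlt
      have hne : {α ∈ S | x ∈ K α}.Nonempty := by
        by_contra hne
        rw [not_nonempty_iff_eq_empty] at hne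
        rw [hne, Real.sSup_empty] at h
        exact absurd hα.1 (not_lt.2 h)
      obtain ⟨γ, hγ, hβγ⟩ := exists_lt_of_lt_csSup hne (hlt.trans_le h)
      exact hK hβ hγ.1 hβγ.le hγ.2
    · intro h
      refine le_of_forall_lt_imp_le_of_dense fun b hb => ?_
      obtain ⟨s, hs, hbs⟩ := exists_mem_Ioo_of_ae hS (le_max_right b 0) (max_lt hb hα.1) hα.2
      exact ((le_max_left b 0).trans hbs.1.le).trans
        (le_csSup ⟨1, fun γ hγ => (hS1 hγ.1).2⟩ ⟨hs, h s hs hbs.2⟩)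
  have hu : IsUSCG u := by
    intro α hα
    obtain ⟨s, hs, hsα⟩ := exists_mem_Ioo_of_ae hS le_rfl hα.1 hα.2
    have heq : cut u α = ⋂ β : {β // β ∈ S ∧ β < α}, K β := by
      ext x
      simp [hcut hα]
    have : Nonempty {β // β ∈ S ∧ β < α} := ⟨⟨s, hs, hsα.2⟩⟩
    rw [heq]
    constructor
    · exact (hc s hs).of_isClosed_subset (isClosed_iInter fun β => (hc β β.2.1).isClosed)
        (iInter_subset (fun β : {β // β ∈ S ∧ β < α} => K β) ⟨s, hs, hsα.2⟩)
    · refine IsCompact.nonempty_iInter_of_directed_nonempty_isCompact_isClosed _ ?_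
        (fun β => hn β β.2.1) (fun β => hc β β.2.1) (fun β => (hc β β.2.1).isClosed)
      refine fun a b => ⟨max a b, ?_, ?_⟩
      · exact hK a.2.1 (max a b).2.1 (Subtype.coe_le_coe.2 (le_max_left a b))
      · exact hK b.2.1 (max a b).2.1 (Subtype.coe_le_coe.2 (le_max_right a b))
  refine ⟨u, hu, ?_⟩
  -- This countable union of compact cuts contains every cut of positive level.
  have hT : IsSeparable (⋃ n : ℕ, cut u (1 / ((n : ℝ) + 1))) :=
    .iUnion fun n => (hu _ ⟨by positivity,
      div_le_one_of_le₀ (by linarith [n.cast_nonneg (α := ℝ)]) (by positivity)⟩).1.isSeparable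
  refine (countable_left_jumps hT fun α hα => (hc α hα).isClosed).mono ?_
  rintro α ⟨hα, hne⟩
  have hsub : K α ⊆ cut u α := fun x hx =>
    (hcut (hS1 hα) x).2 fun β hβ hlt => hK hβ hα hlt.le hx
  obtain ⟨x, hx, hxK⟩ := not_subset.1 fun h => hne (h.antisymm hsub)
  obtain ⟨n, hn⟩ := exists_nat_one_div_lt (hS1 hα).1
  exact ⟨hα, x, mem_iUnion.2 ⟨n, cut_anti u (by positivity) hn.le hx⟩, hxK,
    (hcut (hS1 hα) x).1 hx⟩

/-! ### Levelwise limits and Fatou's lemma -/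

/-- The integral of the Hausdorff distances of the cuts is at most `d_p`. -/
theorem lintegral_hausdorffEDist_le_dp {p : ℝ} (hp : 1 ≤ p) {u v : FuzzySet X} (hu : IsUSCG u)
    (hv : IsUSCG v) :
    ∫⁻ α in Icc (0 : ℝ) 1, hausdorffEDist (cut u α) (cut v α) ≤ dp p u v := by
  have : IsProbabilityMeasure (volume.restrict (Icc (0 : ℝ) 1)) := ⟨by simp⟩
  have h := eLpNorm'_le_eLpNorm'_of_exponent_le zero_lt_one hp
    (volume.restrict (Icc (0 : ℝ) 1)) (hu.aemeasurable hv).aestronglyMeasurable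
  simpa [eLpNorm', dp] using h

theorem ae_tendsto_hausdorffEDist [CompleteSpace X] {p : ℝ} (hp : 1 ≤ p) {u : ℕ → FuzzySet X}
    (hu : ∀ n, IsUSCG (u n)) (h : ∑' n, dp p (u n) (u (n + 1)) ≠ ∞) :
    ∀ᵐ α ∂(volume.restrict (Icc (0 : ℝ) 1)), ∃ K : NonemptyCompacts X,
      Tendsto (fun n => hausdorffEDist (cut (u n) α) K) atTop (𝓝 0) := by
  have hm (n : ℕ) := (hu n).aemeasurable (hu (n + 1))
  have hfin : ∫⁻ α in Icc (0 : ℝ) 1, ∑' n, hausdorffEDist (cut (u n) α) (cut (u (n + 1)) α)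
      ≠ ∞ := by
    rw [lintegral_tsum hm]
    exact ((ENNReal.tsum_le_tsum fun n =>
      lintegral_hausdorffEDist_le_dp hp (hu n) (hu (n + 1))).trans_lt h.lt_top).ne
  filter_upwards [ae_mem_Ioc, ae_lt_top' (AEMeasurable.tsum hm) hfin] with α hα hlt
  let c : ℕ → NonemptyCompacts X := fun n => ⟨⟨cut (u n) α, (hu n α hα).1⟩, (hu n α hα).2⟩
  have hc : CauchySeq c := cauchySeq_of_edist_le_of_tsum_ne_top _ (fun n => le_rfl) hlt.ne
  obtain ⟨K, hK⟩ := cauchySeq_tendsto_of_complete hc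
  exact ⟨K, tendsto_iff_edist_tendsto_0.1 hK⟩

/-- A summable sequence for `d_p` converges levelwise almost everywhere to a fuzzy set. -/
theorem exists_isUSCG_ae_tendsto [CompleteSpace X] {p : ℝ} (hp : 1 ≤ p) {u : ℕ → FuzzySet X}
    (hu : ∀ n, IsUSCG (u n)) (h : ∑' n, dp p (u n) (u (n + 1)) ≠ ∞) :
    ∃ v : FuzzySet X, IsUSCG v ∧ ∀ᵐ α ∂(volume.restrict (Icc (0 : ℝ) 1)),
      Tendsto (fun n => hausdorffEDist (cut (u n) α) (cut v α)) atTop (𝓝 0) := by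
  let S : Set ℝ := {α | α ∈ Ioc (0 : ℝ) 1 ∧ ∃ K : NonemptyCompacts X,
    Tendsto (fun n => hausdorffEDist (cut (u n) α) K) atTop (𝓝 0)}
  have hS : ∀ᵐ α ∂(volume.restrict (Icc (0 : ℝ) 1)), α ∈ S :=
    ae_mem_Ioc.and (ae_tendsto_hausdorffEDist hp hu h)
  have hK : ∀ α, ∃ K : Set X, α ∈ S → IsCompact K ∧ K.Nonempty ∧
      Tendsto (fun n => hausdorffEDist (cut (u n) α) K) atTop (𝓝 0) := fun α => by
    by_cases hα : α ∈ S
    · obtain ⟨K, hK⟩ := hα.2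
      exact ⟨K, fun _ => ⟨K.isCompact, K.nonempty, hK⟩⟩
    · exact ⟨∅, fun h => absurd h hα⟩
  choose K hK using hK
  obtain ⟨v, hv, hcount⟩ := exists_isUSCG_of_antitoneOn hS (fun α hα => hα.1)
    (fun α hα => (hK α hα).1) (fun α hα => (hK α hα).2.1) (fun α hα β hβ hle =>
      subset_of_tendsto_hausdorffEDist (hK α hα).1.isClosed
        (fun n => cut_anti (u n) hα.1.1 hle) (hK β hβ).2.2 (hK α hα).2.2)
  refine ⟨v, hv, ?_⟩
  filter_upwards [hS, hcount.ae_notMem _] with α hα hne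
  have : cut v α = K α := by
    by_contra hne'
    exact hne ⟨hα, hne'⟩
  rw [this]
  exact (hK α hα).2.2

/-- Fatou's lemma for `d_p`. -/
theorem dp_le_of_ae_tendsto {p : ℝ} (hp : 1 ≤ p) {u : ℕ → FuzzySet X} {v w : FuzzySet X}
    (hu : ∀ n, IsUSCG (u n)) (hw : IsUSCG w)
    (h : ∀ᵐ α ∂(volume.restrict (Icc (0 : ℝ) 1)),
      Tendsto (fun n => hausdorffEDist (cut (u n) α) (cut v α)) atTop (𝓝 0))
    {ε : ℝ≥0∞} (hε : ∀ᶠ n in atTop, dp p w (u n) ≤ ε) : dp p w v ≤ ε := by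
  have h0 : 0 < p := by linarith
  unfold dp at hε ⊢
  simp only [one_div, ENNReal.rpow_inv_le_iff h0] at hε ⊢
  calc ∫⁻ α in Icc (0 : ℝ) 1, hausdorffEDist (cut w α) (cut v α) ^ p
      ≤ ∫⁻ α in Icc (0 : ℝ) 1,
          liminf (fun n => hausdorffEDist (cut w α) (cut (u n) α) ^ p) atTop := by
        refine lintegral_mono_ae ?_
        filter_upwards [h] with α hα
        have hle (n : ℕ) : hausdorffEDist (cut w α) (cut v α) ≤
            hausdorffEDist (cut w α) (cut (u n) α) + hausdorffEDist (cut (u n) α) (cut v α) :=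
          hausdorffEDist_triangle
        -- Truncated subtraction is continuous here because the subtrahend tends to `0`; the
        -- distance from `w` to `v` may be infinite.
        have hlim : Tendsto (fun n => hausdorffEDist (cut w α) (cut v α) -
            hausdorffEDist (cut (u n) α) (cut v α)) atTop
            (𝓝 (hausdorffEDist (cut w α) (cut v α))) := by
          simpa using ENNReal.Tendsto.sub tendsto_const_nhds hα (.inr ENNReal.zero_ne_top)
        rw [← ((ENNReal.continuous_rpow_const (y := p)).tendsto _ |>.comp hlim).liminf_eq]
        refine liminf_le_liminf (Eventually.of_forall fun n => ?_)
        exact ENNReal.rpow_le_rpow (tsub_le_iff_right.2 (hle n)) h0.le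
    _ ≤ liminf (fun n => ∫⁻ α in Icc (0 : ℝ) 1,
          hausdorffEDist (cut w α) (cut (u n) α) ^ p) atTop :=
        lintegral_liminf_le' fun n => (hw.aemeasurable (hu n)).pow_const p
    _ ≤ ε ^ p := by
        refine liminf_le_of_frequently_le' hε.frequently

/-- The point `y` lies in every cut of positive level, so the integrand dominates the constant
`edist y x ^ p` on an interval of length one. -/
theorem edist_le_dp_point {p : ℝ} (hp : 1 ≤ p) {u : FuzzySet X} {y : X} (hy : y ∈ cut u 1)
    (x : X) : edist y x ≤ dp p u (point x) := by
  have h0 : 0 < p := by linarith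
  rw [dp, one_div, ENNReal.le_rpow_inv_iff h0]
  calc edist y x ^ p = ∫⁻ _ in Icc (0 : ℝ) 1, edist y x ^ p := by simp
    _ ≤ _ := by
      refine lintegral_mono_ae ?_
      filter_upwards [ae_mem_Ioc] with α hα
      gcongr
      rw [cut_point x ⟨hα.1.le, hα.2⟩, ← infEDist_singleton]
      exact infEDist_le_hausdorffEDist_of_mem (cut_anti u hα.1 hα.2 hy)

end Metric

end FuzzySet

/-! ### Transfer of completeness in both directions -/

namespace FuzzyUSCGp

open FuzzySet

variable {X : Type*} [MetricSpace X] {p : ℝ} [hp : Fact (1 ≤ p)]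

variable (p) in
/-- The crisp point `χ_{x}` as an element of `F¹_USCG(X)^p`. -/
noncomputable def ofPoint (x : X) : FuzzyUSCGp X p where
  toFuzzySet := point x
  isUSCG := isUSCG_point x
  exists_dp_lt_top := ⟨x, by rw [dp_self hp.out]; exact ENNReal.zero_lt_top⟩

theorem isometry_ofPoint : Isometry (ofPoint p : X → FuzzyUSCGp X p) :=
  fun x y => dp_point_point hp.out x y

theorem completeSpace_of_completeSpace [CompleteSpace (FuzzyUSCGp X p)] : CompleteSpace X := by
  refine EMetric.complete_of_cauchySeq_tendsto fun x hx => ?_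
  have hx' : CauchySeq fun n => ofPoint p (x n) :=
    (isometry_ofPoint (p := p)).uniformContinuous.comp_cauchySeq hx
  obtain ⟨u, hu⟩ := cauchySeq_tendsto_of_complete hx'
  obtain ⟨y, hy⟩ := (u.isUSCG 1 (by simp)).2
  refine ⟨y, tendsto_iff_edist_tendsto_0.2 ?_⟩
  refine tendsto_of_tendsto_of_tendsto_of_le_of_le tendsto_const_nhds
    (tendsto_iff_edist_tendsto_0.1 hu) (fun _ => zero_le) fun n => ?_
  rw [edist_comm]
  refine (edist_le_dp_point hp.out hy (x n)).trans_eq ?_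
  rw [edist_comm]
  rfl

instance instCompleteSpace [CompleteSpace X] : CompleteSpace (FuzzyUSCGp X p) := by
  refine EMetric.complete_of_convergent_controlled_sequences (fun n => 2⁻¹ ^ n)
    (fun n => by simp [pos_iff_ne_zero]) fun u hu => ?_
  have hsum : ∑' n, dp p (u n).toFuzzySet (u (n + 1)).toFuzzySet ≠ ∞ := by
    refine ((ENNReal.tsum_le_tsum fun n => (hu n n (n + 1) le_rfl n.le_succ).le).trans_lt ?_).ne
    simp [ENNReal.tsum_geometric]
  obtain ⟨v, hv, hlim⟩ := exists_isUSCG_ae_tendsto hp.out (fun n => (u n).isUSCG) hsum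
  -- Fatou with `u n` fixed and the other index tending to infinity.
  have hdp (n : ℕ) : dp p (u n).toFuzzySet v ≤ 2⁻¹ ^ n :=
    dp_le_of_ae_tendsto hp.out (fun n => (u n).isUSCG) (u n).isUSCG hlim
      ((eventually_ge_atTop n).mono fun m hm => (hu n n m le_rfl hm).le)
  obtain ⟨x, hx⟩ := (u 0).exists_dp_lt_top
  refine ⟨⟨v, hv, x, ?_⟩, tendsto_iff_edist_tendsto_0.2 ?_⟩
  -- The limit is at finite distance from `u 0`, hence from a crisp point.
  · refine (dp_triangle hp.out hv (u 0).isUSCG (isUSCG_point x)).trans_lt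
      (ENNReal.add_lt_top.2 ⟨?_, hx⟩)
    rw [dp_comm]
    exact (hdp 0).trans_lt (by simp)
  · exact tendsto_of_tendsto_of_tendsto_of_le_of_le tendsto_const_nhds
      (ENNReal.tendsto_pow_atTop_nhds_zero_of_lt_one (by simp)) (fun _ => zero_le) hdp

end FuzzyUSCGp

theorem theorem7p1 (X : Type*) [MetricSpace X] (p : ℝ) [Fact (1 ≤ p)] :
    (CompleteSpace X ↔ CompleteSpace (FuzzyUSCGp X p)) ∧
      ∀ m : ℕ, CompleteSpace (FuzzyUSCGp (EuclideanSpace ℝ (Fin m)) p) :=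
  ⟨⟨fun _ => inferInstance, fun _ => FuzzyUSCGp.completeSpace_of_completeSpace (p := p)⟩,
    fun _ => inferInstance⟩
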